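/- **Model.** A knuckle crane has configuration $q=(\alpha,\beta,\gamma,d,\theta_1,\theta_2)^T\in\mathbb R^6$: slew angle, luff angle of the boom, luff angle of the jib, rope length, and the two payload swing angles. Its physical constants are positive: masses $m, m_B, m_J$ of payload, boom and jib, lengths $l_B,l_J$ of boom and jib, moments of inertia $I_{tot},I_B,I_J$, gravitational acceleration $g$, and air friction coefficients $d_{\theta_1},d_{\theta_2}$. Write $S_x=\sin x$, $C_x=\cos x$, and $$A_1=l_B^2\left(m+\tfrac14m_B+m_J\right),\quad A_2=l_J^2\left(m+\tfrac14m_J\right),\quad A_3=l_Bl_J(2m+m_J),\quad A_4=l_Bm,\quad A_5=l_Jm.$$ The equations of motion with input $u\in\mathbb R^4$ are $$M(q)\ddot q+C(q,\dot q)\dot q+F+g(q)=\begin{bmatrix}I_4\\0_{2\times4}\end{bmatrix}u. \qquad (1)$$ Here $M(q)=(m_{ij})$ is the symmetric inertia matrix with entries - $m_{11}=I_{tot}+d^2m+A_1C_\beta^2+A_2C_\gamma^2+A_3C_\beta C_\gamma+2A_4dC_\beta S_{\theta_2}+2A_5dC_\gamma S_{\theta_2}-d^2mC_{\theta_1}^2C_{\theta_2}^2$,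 - $m_{22}=A_1+I_B$, $\ m_{33}=A_2+I_J$, $\ m_{44}=m$, $\ m_{55}=d^2mC_{\theta_2}^2$, $\ m_{66}=d^2m$, - $m_{12}=A_4dC_{\theta_2}S_\beta S_{\theta_1}$, $\ m_{13}=A_5dC_{\theta_2}S_\gamma S_{\theta_1}$, $\ m_{14}=C_{\theta_2}S_{\theta_1}(A_4C_\beta+A_5C_\gamma)$, - $m_{15}=dC_{\theta_1}C_{\theta_2}(A_4C_\beta+A_5C_\gamma+dmS_{\theta_2})$, $\ m_{16}=-dS_{\theta_1}(dm+A_4C_\beta S_{\theta_2}+A_5C_\gamma S_{\theta_2})$, - $m_{23}=\tfrac12A_3C_{\beta-\gamma}$, $\ m_{24}=-A_4(S_\beta S_{\theta_2}+C_\beta C_{\theta_1}C_{\theta_2})$, $\ m_{25}=A_4dC_\beta C_{\theta_2}S_{\theta_1}$, $\ m_{26}=-A_4d(C_{\theta_2}S_\beta-C_\beta C_{\theta_1}S_{\theta_2})$, - $m_{34}=-A_5(S_\gamma S_{\theta_2}+C_\gamma C_{\theta_1}C_{\theta_2})$, $\ m_{35}=A_5dC_\gamma C_{\theta_2}S_{\theta_1}$,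 $\ m_{36}=-A_5d(C_{\theta_2}S_\gamma-C_\gamma C_{\theta_1}S_{\theta_2})$, - $m_{45}=m_{46}=m_{56}=0$. The centripetal-Coriolis matrix is the one given by Lagrange's equations, $C(q,\dot q)_{ij}=\sum_{k=1}^6\left(\frac{\partial m_{ij}}{\partial q_k}-\frac12\frac{\partial m_{kj}}{\partial q_i}\right)\dot q_k$. The air friction vector is $F=(0,0,0,0,\,d_{\theta_1}C_{\theta_2}^2|\theta_1|\dot\theta_1,\,d_{\theta_2}|\theta_2|\dot\theta_2)^T$. The gravity vector is $$g(q)=\left(0,\ \tfrac12gl_BC_\beta(2m+m_B+2m_J),\ \tfrac12gl_JC_\gamma(2m+m_J),\ -gmC_{\theta_1}C_{\theta_2},\ gmdC_{\theta_2}S_{\theta_1},\ gmdC_{\theta_1}S_{\theta_2}\right)^T.$$ **Controller.** Given references $\alpha_d,\beta_d,\gamma_d,d_d\in\mathbb R$ and positive gains $k_{p\alpha},k_{p\beta},k_{p\gamma},k_{pd},k_{d\alpha},k_{d\beta},k_{d\gamma},k_{dd}$, let $$\begin{aligned}u_1&=k_{p\alpha}(\alpha_d-\alpha)-k_{d\alpha}\dot\alpha,\\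 u_2&=k_{p\beta}(\beta_d-\beta)-k_{d\beta}\dot\beta+gl_BC_\beta\left(m+\tfrac12m_B+m_J\right),\\ u_3&=k_{p\gamma}(\gamma_d-\gamma)-k_{d\gamma}\dot\gamma+gl_JC_\gamma\left(m+\tfrac12m_J\right),\\ u_4&=k_{pd}(d_d-d)-k_{dd}\dot d-mg.\end{aligned}\qquad(2)$$ **Theorem.** Let the desired configuration $q_d=(\alpha_d,\beta_d,\gamma_d,d_d,0,0)$ satisfy the standing assumptions $|\theta_1|,|\theta_2|<\pi/2$ and $d>0$, that is, let $d_d>0$. Then the state $(q,\dot q)=(q_d,0)$ is an asymptotically stable equilibrium of the closed loop (1)–(2). Explicitly: the constant curve $(q_d,0)$ is a trajectory; trajectories on $[0,\infty)$ exist for all initial states $(q(0),\dot q(0))$ close enough to $(q_d,0)$; for every $\varepsilon>0$ there is $\delta>0$ such that every trajectory, on any interval $[0,T)$, that starts within $\delta$ of $(q_d,0)$ stays within $\varepsilon$ of it (so trajectories that start close enough to $(q_d,0)$ satisfy the standing assumptions at all times); and every trajectory on $[0,\infty)$ that starts close enough to $(q_d,0)$ converges to $(q_d,0)$ as $t\to\infty$.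 -/

import Mathlib

open Real Filter Topology Set
open scoped Matrix

noncomputable section

namespace KnuckleCrane

/-- Physical constants of the crane: payload, boom and jib masses `m`, `mB`, `mJ`; boom and jib
lengths `lB`, `lJ`; moments of inertia `Itot`, `IB`, `IJ` of the slew, luff and jib rotations;
gravitational acceleration `g`; air friction coefficients `dθ₁`, `dθ₂` of the two swing angles. -/
structure Params where
  m : ℝ
  mB : ℝ
  mJ : ℝ
  lB : ℝ
  lJ : ℝ
  Itot : ℝ
  IB : ℝ
  IJ : ℝ
  g : ℝ
  dθ₁ : ℝ
  dθ₂ : ℝ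
  m_pos : 0 < m
  mB_pos : 0 < mB
  mJ_pos : 0 < mJ
  lB_pos : 0 < lB
  lJ_pos : 0 < lJ
  Itot_pos : 0 < Itot
  IB_pos : 0 < IB
  IJ_pos : 0 < IJ
  g_pos : 0 < g
  dθ₁_pos : 0 < dθ₁
  dθ₂_pos : 0 < dθ₂

/-- Positive proportional and derivative control gains of the four actuated coordinates. -/
structure Gains where
  kp : Fin 4 → ℝ
  kd : Fin 4 → ℝ
  kp_pos : ∀ i, 0 < kp i
  kd_pos : ∀ i, 0 < kd i

/-- Configurations `q = (α, β, γ, d, θ₁, θ₂)`: slew angle, luff angle of the boom, luff angle of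
the jib, rope length, and the two payload swing angles. The same type is used for velocities. -/
abbrev Config := Fin 6 → ℝ

/-- States `(q, q̇)`. -/
abbrev State := Config × Config

namespace Params

variable (p : Params)

def A₁ : ℝ := p.lB ^ 2 * p.m + p.lB ^ 2 * p.mB / 4 + p.lB ^ 2 * p.mJ

def A₂ : ℝ := p.lJ ^ 2 * p.m + p.lJ ^ 2 * p.mJ / 4

def A₃ : ℝ := 2 * p.lB * p.lJ * p.m + p.lB * p.lJ * p.mJ

def A₄ : ℝ := p.lB * p.m

def A₅ : ℝ := p.lJ * p.m

end Params

/-- The six diagonal entries `m₁₁, …, m₆₆` of the inertia matrix. -/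
def inertiaDiag (p : Params) (q : Config) : Fin 6 → ℝ :=
  ![p.Itot + q 3 ^ 2 * p.m + p.A₁ * cos (q 1) ^ 2 + p.A₂ * cos (q 2) ^ 2
      + p.A₃ * cos (q 1) * cos (q 2)
      + 2 * p.A₄ * q 3 * cos (q 1) * sin (q 5) + 2 * p.A₅ * q 3 * cos (q 2) * sin (q 5)
      - q 3 ^ 2 * p.m * cos (q 4) ^ 2 * cos (q 5) ^ 2,
    p.A₁ + p.IB,
    p.A₂ + p.IJ,
    p.m,
    q 3 ^ 2 * p.m * cos (q 5) ^ 2,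
    q 3 ^ 2 * p.m]

def m₁₂ (p : Params) (q : Config) : ℝ := p.A₄ * q 3 * cos (q 5) * sin (q 1) * sin (q 4)

def m₁₃ (p : Params) (q : Config) : ℝ := p.A₅ * q 3 * cos (q 5) * sin (q 2) * sin (q 4)

def m₁₄ (p : Params) (q : Config) : ℝ :=
  cos (q 5) * sin (q 4) * (p.A₄ * cos (q 1) + p.A₅ * cos (q 2))

def m₁₅ (p : Params) (q : Config) : ℝ :=
  q 3 * cos (q 4) * cos (q 5)
    * (p.A₄ * cos (q 1) + p.A₅ * cos (q 2) + q 3 * p.m * sin (q 5))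

def m₁₆ (p : Params) (q : Config) : ℝ :=
  -(q 3 * sin (q 4)
    * (q 3 * p.m + p.A₄ * cos (q 1) * sin (q 5) + p.A₅ * cos (q 2) * sin (q 5)))

def m₂₃ (p : Params) (q : Config) : ℝ := 1 / 2 * (p.A₃ * cos (q 1 - q 2))

def m₂₄ (p : Params) (q : Config) : ℝ :=
  -(p.A₄ * (sin (q 1) * sin (q 5) + cos (q 1) * cos (q 4) * cos (q 5)))

def m₂₅ (p : Params) (q : Config) : ℝ := p.A₄ * q 3 * cos (q 1) * cos (q 5) * sin (q 4)

def m₂₆ (p : Params) (q : Config) : ℝ :=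
  -(p.A₄ * q 3 * (cos (q 5) * sin (q 1) - cos (q 1) * cos (q 4) * sin (q 5)))

def m₃₄ (p : Params) (q : Config) : ℝ :=
  -(p.A₅ * (sin (q 2) * sin (q 5) + cos (q 2) * cos (q 4) * cos (q 5)))

def m₃₅ (p : Params) (q : Config) : ℝ := p.A₅ * q 3 * cos (q 2) * cos (q 5) * sin (q 4)

def m₃₆ (p : Params) (q : Config) : ℝ :=
  -(p.A₅ * q 3 * (cos (q 5) * sin (q 2) - cos (q 2) * cos (q 4) * sin (q 5)))

/-- The inertia matrix `M(q)`, i.e. the matrix of the kinetic energy `½ q̇ᵀ M(q) q̇`. -/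
def inertia (p : Params) (q : Config) : Matrix (Fin 6) (Fin 6) ℝ :=
  !![inertiaDiag p q 0, m₁₂ p q, m₁₃ p q, m₁₄ p q, m₁₅ p q, m₁₆ p q;
     m₁₂ p q, inertiaDiag p q 1, m₂₃ p q, m₂₄ p q, m₂₅ p q, m₂₆ p q;
     m₁₃ p q, m₂₃ p q, inertiaDiag p q 2, m₃₄ p q, m₃₅ p q, m₃₆ p q;
     m₁₄ p q, m₂₄ p q, m₃₄ p q, inertiaDiag p q 3, 0, 0;
     m₁₅ p q, m₂₅ p q, m₃₅ p q, 0, inertiaDiag p q 4, 0;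
     m₁₆ p q, m₂₆ p q, m₃₆ p q, 0, 0, inertiaDiag p q 5]

/-- The partial derivative `∂ mᵢⱼ / ∂ qₖ` of an entry of the inertia matrix. -/
def inertiaPartial (p : Params) (q : Config) (k i j : Fin 6) : ℝ :=
  fderiv ℝ (fun x : Config => inertia p x i j) q (Pi.single k 1)

/-- The centripetal-Coriolis matrix given by Lagrange's equations,
`cᵢⱼ = ∑ₖ (∂mᵢⱼ/∂qₖ - ½ ∂mₖⱼ/∂qᵢ) q̇ₖ`, so that
`C(q, q̇) q̇ = Ṁ(q) q̇ - ½ ∂(q̇ᵀ M(q) q̇)/∂q`. -/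
def coriolis (p : Params) (q v : Config) : Matrix (Fin 6) (Fin 6) ℝ :=
  Matrix.of fun i j =>
    ∑ k, (inertiaPartial p q k i j - 1 / 2 * inertiaPartial p q i k j) * v k

/-- The air friction vector `F`. -/
def friction (p : Params) (q v : Config) : Config :=
  ![0, 0, 0, 0,
    p.dθ₁ * cos (q 5) ^ 2 * |q 4| * v 4,
    p.dθ₂ * |q 5| * v 5]

/-- The gravity vector `g(q)`, i.e. the gradient of the potential energy. -/
def gravity (p : Params) (q : Config) : Config :=
  ![0,
    1 / 2 * p.g * p.lB * cos (q 1) * (2 * p.m + p.mB + 2 * p.mJ),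
    1 / 2 * p.g * p.lJ * cos (q 2) * (2 * p.m + p.mJ),
    -(p.g * p.m * cos (q 4) * cos (q 5)),
    p.g * p.m * q 3 * cos (q 5) * sin (q 4),
    p.g * p.m * q 3 * cos (q 4) * sin (q 5)]

/-- The `6 × 4` block matrix `[I₄; 0]` through which the inputs act. -/
def inputMatrix : Matrix (Fin 6) (Fin 4) ℝ :=
  Matrix.of fun i j => if (i : ℕ) = (j : ℕ) then 1 else 0

/-- The PD controller with gravity compensation; `r = (α_d, β_d, γ_d, d_d)` are the references. -/
def controller (p : Params) (K : Gains) (r : Fin 4 → ℝ) (q v : Config) : Fin 4 → ℝ :=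
  ![K.kp 0 * (r 0 - q 0) - K.kd 0 * v 0,
    K.kp 1 * (r 1 - q 1) - K.kd 1 * v 1
      + p.g * p.lB * cos (q 1) * (p.m + 1 / 2 * p.mB + p.mJ),
    K.kp 2 * (r 2 - q 2) - K.kd 2 * v 2
      + p.g * p.lJ * cos (q 2) * (p.m + 1 / 2 * p.mJ),
    K.kp 3 * (r 3 - q 3) - K.kd 3 * v 3 - p.m * p.g]

/-- The equations of motion `M(q) a + C(q, v) v + F + g(q) = [I₄; 0] u` with `v = q̇`, `a = q̈`. -/
def EquationOfMotion (p : Params) (q v a : Config) (u : Fin 4 → ℝ) : Prop :=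
  inertia p q *ᵥ a + coriolis p q v *ᵥ v + friction p q v + gravity p q = inputMatrix *ᵥ u

/-- `x = (q, q̇)` is a trajectory of the closed loop on the time interval `I`: at every time `t` of
`I` the curve `x` is differentiable within `I`, with derivative `(q̇(t), a)` for an acceleration `a`
that satisfies the equations of motion under the control law. -/
def IsClosedLoopSolution (p : Params) (K : Gains) (r : Fin 4 → ℝ) (I : Set ℝ)
    (x : ℝ → State) : Prop :=
  ∀ t ∈ I, ∃ a : Config, HasDerivWithinAt x ((x t).2, a) I t ∧
    EquationOfMotion p (x t).1 (x t).2 a (controller p K r (x t).1 (x t).2)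

/-- The standing assumptions on a configuration: positive rope length, and swing angles strictly
between `-π/2` and `π/2`. -/
def Admissible (q : Config) : Prop :=
  0 < q 3 ∧ |q 4| < π / 2 ∧ |q 5| < π / 2

/-- The desired equilibrium `(α_d, β_d, γ_d, d_d, 0, 0)` with zero velocities. -/
def desiredState (r : Fin 4 → ℝ) : State :=
  (![r 0, r 1, r 2, r 3, 0, 0], 0)

end KnuckleCrane

/-- Asymptotic stability in the sense of Lyapunov of a point `xe`, for an autonomous system given
by the predicate `Sol I x`, meaning that `x` is a trajectory on the time interval `I`:
* `xe` is an equilibrium;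
* trajectories on `[0, ∞)` exist for all initial states near `xe`;
* `xe` is stable: every trajectory, on any interval `[0, T)`, that starts near enough to `xe` stays
  as near to `xe` as prescribed;
* `xe` is attractive: every trajectory on `[0, ∞)` that starts near enough to `xe` converges to
  `xe`. -/
structure IsAsymptoticallyStable {X : Type*} [PseudoMetricSpace X]
    (Sol : Set ℝ → (ℝ → X) → Prop) (xe : X) : Prop where
  equilibrium : Sol (Ici 0) (fun _ => xe)
  exists_solution : ∃ δ > 0, ∀ x₀ : X, dist x₀ xe < δ → ∃ x : ℝ → X, x 0 = x₀ ∧ Sol (Ici 0) x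
  stable : ∀ ε > 0, ∃ δ > 0, ∀ (T : ℝ) (x : ℝ → X), Sol (Ico 0 T) x → dist (x 0) xe < δ →
    ∀ t ∈ Ico 0 T, dist (x t) xe < ε
  attractive : ∃ δ > 0, ∀ x : ℝ → X, Sol (Ici 0) x → dist (x 0) xe < δ →
    Tendsto x atTop (𝓝 xe)

end

/-! ### Lyapunov and LaSalle theory for Lipschitz vector fields. -/

section LaSalle

open Metric
open scoped NNReal

variable {E : Type*} [NormedAddCommGroup E] [NormedSpace ℝ E]

/-! The Lyapunov function is `energy`. The controller cancels gravity in the two luff equations, its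
constant rope force turns the payload potential into m g d (1 - cos θ₁ cos θ₂), and the proportional
gains act as springs. The kinetic energy is a sum of squares (`dotProduct_inertia_mulVec`), definite
for d > 0 and swing angles below π/2, so the energy has a strict minimum at the desired state
(`energy_pos`). The Coriolis terms cancel half the change of the inertia matrix, and the energy
decays at the rate `dissipation` (`fderiv_energy_apply`).

The dissipation is only semidefinite, so convergence needs LaSalle's principle
(`tendsto_of_lyapunov`). Along a solution without dissipation the actuated velocities vanish and
each swing angle satisfies θ θ' = 0. Hence θ² is constant and the swing velocities vanish too
(`deriv_eq_zero_of_mul_deriv_eq_zero`). The crane is then at rest, which is possible only at the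
desired configuration (`eq_desiredState_of_rest`).

Because friction contains |θ|, the vector field is treated as locally Lipschitz, which is enough for
uniqueness and continuous dependence. Composing it with the retraction `clamp` onto a small ball
gives a bounded, globally Lipschitz field with global solutions. Stability traps nearby trajectories
in the ball, where the two fields agree. -/

/-- A bounded Lipschitz vector field on a Banach space has forward solutions for all times. -/
theorem exists_forward_solution_of_lipschitz_of_bounded [CompleteSpace E] {f : E → E} {K L : ℝ≥0}
    (hf : LipschitzWith K f) (hL : ∀ x, ‖f x‖ ≤ L) (x₀ : E) :
    ∃ x : ℝ → E, x 0 = x₀ ∧ ∀ t ∈ Ici (0 : ℝ), HasDerivWithinAt x (f (x t)) (Ici 0) t := by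
  have key : ∀ n : ℕ, ∃ x : ℝ → E, x 0 = x₀ ∧
      ∀ t ∈ Icc (0 : ℝ) n, HasDerivWithinAt x (f (x t)) (Icc 0 n) t := by
    intro n
    have hn : (0 : ℝ) ≤ n := n.cast_nonneg
    -- The radius `L * n` is as far as a curve of speed at most `L` can travel in time `n`, so one
    -- Picard–Lindelöf step covers the whole interval.
    have hPL : IsPicardLindelof (fun _ => f) (⟨0, left_mem_Icc.2 hn⟩ : Icc (0 : ℝ) n) x₀
        (L * n) 0 L K :=
      { lipschitzOnWith := fun t _ => hf.lipschitzOnWith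
        continuousOn := fun x _ => continuousOn_const
        norm_le := fun t _ x _ => hL x
        mul_max_le := by simp }
    obtain ⟨x, h0, hx⟩ := hPL.exists_eq_forall_mem_Icc_hasDerivWithinAt₀
    exact ⟨x, h0, hx⟩
  choose X hX0 hX using key
  have hright : ∀ n : ℕ, ∀ t ∈ Ico (0 : ℝ) n, HasDerivWithinAt (X n) (f (X n t)) (Ici t) t := by
    intro n t ht
    exact ((hX n t (Ico_subset_Icc_self ht)).mono (Icc_subset_Icc_left ht.1)).mono_of_mem_nhdsWithin
      (Icc_mem_nhdsGE ht.2)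
  have hcont : ∀ n : ℕ, ContinuousOn (X n) (Icc (0 : ℝ) n) :=
    fun n t ht => (hX n t ht).continuousWithinAt
  have hagree : ∀ n k : ℕ, n ≤ k → EqOn (X n) (X k) (Icc (0 : ℝ) n) := by
    intro n k hnk
    have hnk' : (n : ℝ) ≤ k := by exact_mod_cast hnk
    exact ODE_solution_unique (v := fun _ => f) (fun _ => hf) (hcont n) (hright n)
      ((hcont k).mono (Icc_subset_Icc_right hnk'))
      (fun t ht => hright k t ⟨ht.1, ht.2.trans_le hnk'⟩) ((hX0 n).trans (hX0 k).symm)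
  -- The solutions on [0, n] agree by uniqueness, so at time `t` any horizon beyond `t` may be used.
  set x : ℝ → E := fun t => X ⌈t⌉₊ t with hx
  have hxX : ∀ n : ℕ, EqOn x (X n) (Icc (0 : ℝ) n) := by
    intro n t ht
    exact hagree _ n (Nat.ceil_le.2 ht.2) ⟨ht.1, Nat.le_ceil t⟩
  refine ⟨x, by simp [hx, hX0], fun t ht => ?_⟩
  obtain ⟨n, hn⟩ := exists_nat_gt t
  have ht' : t ∈ Icc (0 : ℝ) n := ⟨ht, hn.le⟩
  have h1 : HasDerivWithinAt x (f (x t)) (Icc (0 : ℝ) n) t := by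
    rw [hxX n ht']
    exact (hX n t ht').congr (hxX n) (hxX n ht')
  refine h1.mono_of_mem_nhdsWithin ?_
  rw [← Ici_inter_Iic]
  exact inter_mem_nhdsWithin _ (Iic_mem_nhds hn)

section Lyapunov

variable {f : E → E} {V : E → ℝ} {V' : E → E →L[ℝ] ℝ} {xe : E} {R : ℝ}

/-- A Lyapunov function does not increase along solutions that stay in its domain. -/
theorem antitoneOn_lyapunov
    (hV : ∀ y ∈ closedBall xe R, HasFDerivAt V (V' y) y)
    (hdec : ∀ y ∈ closedBall xe R, V' y (f y) ≤ 0)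
    {I J : Set ℝ} {x : ℝ → E} (hI : Convex ℝ I) (hIJ : I ⊆ J)
    (hx : ∀ t ∈ I, HasDerivWithinAt x (f (x t)) J t) (hmem : ∀ t ∈ I, x t ∈ closedBall xe R) :
    AntitoneOn (V ∘ x) I := by
  have hd : ∀ t ∈ I, HasDerivWithinAt (V ∘ x) (V' (x t) (f (x t))) I t := fun t ht =>
    (hV _ (hmem t ht)).comp_hasDerivWithinAt t ((hx t ht).mono hIJ)
  exact antitoneOn_of_hasDerivWithinAt_nonpos hI (fun t ht => (hd t ht).continuousWithinAt)
    (fun t ht => (hd t (interior_subset ht)).mono interior_subset)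
    (fun t ht => hdec _ (hmem t (interior_subset ht)))

/-- Lyapunov's stability theorem. The curve `x` has to be a solution only where it is in the domain
of the Lyapunov function. -/
theorem stable_of_lyapunov [ProperSpace E]
    (hV : ∀ y ∈ closedBall xe R, HasFDerivAt V (V' y) y)
    (hdec : ∀ y ∈ closedBall xe R, V' y (f y) ≤ 0)
    (hV0 : V xe = 0) (hpos : ∀ y ∈ closedBall xe R, y ≠ xe → 0 < V y)
    {ε : ℝ} (hε : 0 < ε) (hεR : ε ≤ R) :
    ∃ δ > 0, ∀ (T : ℝ) (x : ℝ → E), ContinuousOn x (Ico 0 T) →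
      (∀ t ∈ Ico 0 T, x t ∈ closedBall xe R → HasDerivWithinAt x (f (x t)) (Ico 0 T) t) →
      dist (x 0) xe < δ → ∀ t ∈ Ico 0 T, dist (x t) xe < ε := by
  have hsub : sphere xe ε ⊆ closedBall xe R :=
    sphere_subset_closedBall.trans (closedBall_subset_closedBall hεR)
  have hcont : ContinuousOn V (closedBall xe R) :=
    fun y hy => (hV y hy).continuousAt.continuousWithinAt
  -- By compactness `V` is at least some `c > 0` on the sphere of radius `ε`. A curve that starts
  -- where `V < c` cannot reach the sphere while `V` decreases.
  obtain ⟨c, hc, hcV⟩ := (isCompact_sphere xe ε).exists_forall_le' (hcont.mono hsub)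
    (a := 0) (fun y hy => hpos y (hsub hy) (ne_of_mem_sphere hy hε.ne'))
  have hVc : ∀ᶠ y in 𝓝 xe, V y < c :=
    (hV xe (mem_closedBall_self (hε.le.trans hεR))).continuousAt.eventually_lt_const (by rwa [hV0])
  obtain ⟨δ, hδ, hδV⟩ := Metric.eventually_nhds_iff.1 hVc
  refine ⟨min δ ε, lt_min hδ hε, fun T x hxc hx h0 t ht => ?_⟩
  by_contra! hlt
  have hIcc : Icc 0 t ⊆ Ico 0 T := fun s hs => ⟨hs.1, hs.2.trans_lt ht.2⟩
  have hdist : ContinuousOn (fun s => dist (x s) xe) (Icc 0 t) :=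
    (continuous_id.dist continuous_const).comp_continuousOn (hxc.mono hIcc)
  have hcl : IsCompact (Icc 0 t ∩ (fun s => dist (x s) xe) ⁻¹' Ici ε) :=
    isCompact_Icc.of_isClosed_subset (hdist.preimage_isClosed_of_isClosed isClosed_Icc isClosed_Ici)
      inter_subset_left
  -- `s` is the first time at distance at least `ε`; the intermediate value theorem makes the
  -- distance exactly `ε`. Up to then the curve lies in the domain of `V`.
  obtain ⟨s, ⟨hs, hsε⟩, hmin⟩ := hcl.exists_isLeast ⟨t, ⟨ht.1, le_rfl⟩, hlt⟩
  have hsub' : Icc 0 s ⊆ Icc 0 t := Icc_subset_Icc_right hs.2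
  obtain ⟨s', hs', hs'ε⟩ := intermediate_value_Icc hs.1 (hdist.mono hsub')
    ⟨(h0.trans_le (min_le_right _ _)).le, hsε⟩
  have hss' : s = s' := le_antisymm (hmin ⟨hsub' hs', hs'ε.ge⟩) hs'.2
  subst hss'
  have hle : ∀ r ∈ Icc 0 s, x r ∈ closedBall xe R := by
    intro r hr
    refine mem_closedBall.2 (le_trans ?_ hεR)
    rcases hr.2.eq_or_lt with rfl | hrs
    · exact hs'ε.le
    · by_contra! h
      exact absurd (hmin ⟨hsub' hr, h.le⟩) (not_le.2 hrs)
  have hanti := antitoneOn_lyapunov hV hdec (convex_Icc 0 s) (hsub'.trans hIcc)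
    (fun r hr => hx r (hIcc (hsub' hr)) (hle r hr)) hle
  have h1 := hanti (left_mem_Icc.2 hs.1) (right_mem_Icc.2 hs.1) hs.1
  have h2 := hδV (h0.trans_le (min_le_left _ _))
  have h3 := hcV (x s) hs'ε
  simp only [Function.comp_apply] at h1
  linarith

/-- LaSalle's invariance principle: if the constant curve is the only solution along which the
Lyapunov function has derivative zero, then solutions in its domain converge. -/
theorem tendsto_of_lyapunov [ProperSpace E] {K L : ℝ≥0}
    (hf : LipschitzWith K f) (hL : ∀ x, ‖f x‖ ≤ L)
    (hV : ∀ y ∈ closedBall xe R, HasFDerivAt V (V' y) y)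
    (hdec : ∀ y ∈ closedBall xe R, V' y (f y) ≤ 0)
    (hV0 : V xe = 0) (hpos : ∀ y ∈ closedBall xe R, y ≠ xe → 0 < V y)
    (hinv : ∀ φ : ℝ → E, (∀ t ∈ Icc (0 : ℝ) 1, HasDerivWithinAt φ (f (φ t)) (Icc 0 1) t ∧
      φ t ∈ closedBall xe R ∧ V' (φ t) (f (φ t)) = 0) → φ 0 = xe)
    {x : ℝ → E} (hx : ∀ t ∈ Ici (0 : ℝ), HasDerivWithinAt x (f (x t)) (Ici 0) t)
    (hmem : ∀ t ∈ Ici (0 : ℝ), x t ∈ closedBall xe R) :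
    Tendsto x atTop (𝓝 xe) := by
  have hcont : ContinuousOn V (closedBall xe R) :=
    fun y hy => (hV y hy).continuousAt.continuousWithinAt
  have hVnn : ∀ y ∈ closedBall xe R, 0 ≤ V y := by
    intro y hy
    rcases eq_or_ne y xe with rfl | h
    · exact hV0.ge
    · exact (hpos y hy h).le
  have hanti : AntitoneOn (V ∘ x) (Ici 0) :=
    antitoneOn_lyapunov hV hdec (convex_Ici 0) subset_rfl hx hmem
  obtain ⟨l, hl⟩ : ∃ l, Tendsto (V ∘ x) atTop (𝓝 l) := by
    have hanti' : Antitone (fun t => V (x (max t 0))) := fun a b hab =>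
      hanti (mem_Ici.2 (le_max_right a 0)) (mem_Ici.2 (le_max_right b 0))
        (max_le_max_right 0 hab)
    refine ⟨_, (tendsto_atTop_ciInf hanti' ⟨0, ?_⟩).congr' ?_⟩
    · rintro _ ⟨t, rfl⟩
      exact hVnn _ (hmem _ (le_max_right t 0))
    · filter_upwards [eventually_ge_atTop 0] with t ht
      simp [max_eq_left ht]
  -- By compactness it is enough that every cluster point `y` equals `xe`. Take an ultrafilter `U`
  -- of times along which `x` tends to `y`, and the solution `φ` that starts at `y`.
  refine (isCompact_closedBall xe R).tendsto_nhds_of_unique_mapClusterPt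
    ((eventually_ge_atTop 0).mono hmem) fun y _ hy => ?_
  obtain ⟨U, hU, hUy⟩ := mapClusterPt_iff_ultrafilter.1 hy
  obtain ⟨φ, hφ0, hφ⟩ := exists_forward_solution_of_lipschitz_of_bounded hf hL y
  have hright : ∀ {z : ℝ → E}, (∀ t ∈ Ici (0 : ℝ), HasDerivWithinAt z (f (z t)) (Ici 0) t) →
      ∀ t ∈ Ici (0 : ℝ), HasDerivWithinAt z (f (z t)) (Ici t) t :=
    fun hz t ht => (hz t ht).mono (Ici_subset_Ici.2 ht)
  -- Grönwall's inequality compares the time-shifted solution with `φ`: their distance at time `s`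
  -- is at most `exp (K * s)` times the initial one.
  have hlim : ∀ s ∈ Icc (0 : ℝ) 1, Tendsto (fun t => x (t + s)) U (𝓝 (φ s)) := by
    intro s hs
    have hbound : ∀ᶠ t in (U : Filter ℝ), dist (x (t + s)) (φ s) ≤ dist (x t) y * exp (K * s) := by
      filter_upwards [hU (eventually_ge_atTop 0)] with t ht
      have hxt : ∀ r ∈ Ici (0 : ℝ), HasDerivWithinAt (fun r => x (t + r)) (f (x (t + r)))
          (Ici 0) r := by
        intro r hr
        have hr' : t + r ∈ Ici (0 : ℝ) := add_nonneg ht hr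
        have := (hx (t + r) hr').scomp r ((hasDerivWithinAt_id r (Ici 0)).const_add t)
          (fun q hq => add_nonneg ht hq)
        simpa [Function.comp_def] using this
      have := dist_le_of_trajectories_ODE (v := fun _ => f) (a := 0) (b := 1)
        (f := fun r => x (t + r)) (g := φ) (δ := dist (x t) y) (fun _ => hf)
        (fun r hr => ((hxt r hr.1).continuousWithinAt).mono Icc_subset_Ici_self)
        (fun r hr => hright hxt r hr.1)
        (fun r hr => ((hφ r hr.1).continuousWithinAt).mono Icc_subset_Ici_self)
        (fun r hr => hright hφ r hr.1) (by simp [hφ0]) s hs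
      simpa using this
    refine tendsto_iff_dist_tendsto_zero.2 (squeeze_zero' (Eventually.of_forall fun _ => dist_nonneg)
      hbound ?_)
    simpa using (tendsto_iff_dist_tendsto_zero.1 hUy).mul_const (exp (K * s))
  have hshift : ∀ s ∈ Icc (0 : ℝ) 1, ∀ᶠ t in (U : Filter ℝ), x (t + s) ∈ closedBall xe R := by
    intro s hs
    filter_upwards [hU (eventually_ge_atTop 0)] with t ht
    exact hmem _ (add_nonneg ht hs.1)
  have hφmem : ∀ s ∈ Icc (0 : ℝ) 1, φ s ∈ closedBall xe R := fun s hs =>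
    isClosed_closedBall.mem_of_tendsto (hlim s hs) (hshift s hs)
  -- `V ∘ x` has the same limit `l` after any time shift, so `V` is constant along `φ` and its
  -- derivative there vanishes.
  have hφV : ∀ s ∈ Icc (0 : ℝ) 1, V (φ s) = l := by
    intro s hs
    refine tendsto_nhds_unique ((hV _ (hφmem s hs)).continuousAt.tendsto.comp (hlim s hs)) ?_
    exact hl.comp ((tendsto_atTop_add_const_right atTop s tendsto_id).mono_left hU)
  rw [← hφ0]
  refine hinv φ fun t ht => ⟨(hφ t ht.1).mono Icc_subset_Ici_self, hφmem t ht, ?_⟩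
  have h1 : HasDerivWithinAt (V ∘ φ) (V' (φ t) (f (φ t))) (Icc 0 1) t :=
    (hV _ (hφmem t ht)).comp_hasDerivWithinAt t ((hφ t ht.1).mono Icc_subset_Ici_self)
  have h2 : HasDerivWithinAt (V ∘ φ) 0 (Icc 0 1) t :=
    (hasDerivWithinAt_const t (Icc 0 1) l).congr hφV (hφV t ht)
  exact (uniqueDiffOn_Icc zero_lt_one t ht).eq_deriv _ h1 h2

/-- The Barbashin–Krasovskii–LaSalle theorem, for a differential relation `x' = w` with `G x w` that
agrees with the vector field `f` near the equilibrium. -/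
theorem isAsymptoticallyStable_of_lyapunov [ProperSpace E] {K L : ℝ≥0} {G : E → E → Prop}
    (hR : 0 < R) (hf : LipschitzWith K f) (hL : ∀ x, ‖f x‖ ≤ L) (hfe : f xe = 0)
    (hG : ∀ y ∈ closedBall xe R, ∀ w, G y w ↔ w = f y)
    (hV : ∀ y ∈ closedBall xe R, HasFDerivAt V (V' y) y)
    (hdec : ∀ y ∈ closedBall xe R, V' y (f y) ≤ 0)
    (hV0 : V xe = 0) (hpos : ∀ y ∈ closedBall xe R, y ≠ xe → 0 < V y)
    (hinv : ∀ φ : ℝ → E, (∀ t ∈ Icc (0 : ℝ) 1, HasDerivWithinAt φ (f (φ t)) (Icc 0 1) t ∧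
      φ t ∈ closedBall xe R ∧ V' (φ t) (f (φ t)) = 0) → φ 0 = xe) :
    IsAsymptoticallyStable
      (fun I x => ∀ t ∈ I, ∃ w, HasDerivWithinAt x w I t ∧ G (x t) w) xe := by
  have hderiv : ∀ {I : Set ℝ} {x : ℝ → E} {t : ℝ}, x t ∈ closedBall xe R →
      ((∃ w, HasDerivWithinAt x w I t ∧ G (x t) w) ↔ HasDerivWithinAt x (f (x t)) I t) := by
    intro I x t ht
    constructor
    · rintro ⟨w, hw, hGw⟩
      rwa [(hG _ ht w).1 hGw] at hw
    · exact fun h => ⟨_, h, (hG _ ht _).2 rfl⟩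
  -- Stability with `ε = R` provides the trapping neighbourhood used for both existence and
  -- attraction.
  obtain ⟨δ, hδ, hstab⟩ := stable_of_lyapunov hV hdec hV0 hpos hR le_rfl
  have hstay : ∀ x : ℝ → E, ContinuousOn x (Ici 0) →
      (∀ t ∈ Ici (0 : ℝ), x t ∈ closedBall xe R → HasDerivWithinAt x (f (x t)) (Ici 0) t) →
      dist (x 0) xe < δ → ∀ t ∈ Ici (0 : ℝ), x t ∈ closedBall xe R := by
    intro x hc hx h0 t ht
    exact (hstab (t + 1) x (hc.mono Ico_subset_Ici_self)
      (fun s hs hsR => (hx s hs.1 hsR).mono Ico_subset_Ici_self) h0 t ⟨ht, lt_add_one t⟩).le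
  refine ⟨fun t _ => (hderiv (mem_closedBall_self hR.le)).2 ?_, ⟨δ, hδ, fun x₀ hx₀ => ?_⟩,
    fun ε hε => ?_, ⟨δ, hδ, fun x hx h0 => ?_⟩⟩
  · simpa [hfe] using hasDerivWithinAt_const t (Ici 0) xe
  · obtain ⟨x, hx0, hx⟩ := exists_forward_solution_of_lipschitz_of_bounded hf hL x₀
    refine ⟨x, hx0, fun t ht => (hderiv ?_).2 (hx t ht)⟩
    exact hstay x (fun t ht => (hx t ht).continuousWithinAt) (fun t ht _ => hx t ht)
      (by rwa [hx0]) t ht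
  · obtain ⟨η, hη, h⟩ := stable_of_lyapunov hV hdec hV0 hpos (lt_min hε hR) (min_le_right ε R)
    refine ⟨η, hη, fun T x hx h0 t ht => (h T x (fun s hs => ?_)
      (fun s hs hsR => (hderiv hsR).1 (hx s hs)) h0 t ht).trans_le (min_le_left ε R)⟩
    obtain ⟨w, hw, -⟩ := hx s hs
    exact hw.continuousWithinAt
  · have hmem := hstay x (fun t ht => (hx t ht).choose_spec.1.continuousWithinAt)
      (fun t ht htR => (hderiv htR).1 (hx t ht)) h0
    exact tendsto_of_lyapunov hf hL hV hdec hV0 hpos hinv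
      (fun t ht => (hderiv (hmem t ht)).1 (hx t ht)) hmem

end Lyapunov

end LaSalle

/-! ### Kinetic energy, inertia matrix and the energy balance. -/

namespace KnuckleCrane

/-- Twice the kinetic energy is a sum of squares: rotational energies, boom, jib, and the squared
velocity of the payload in the slewing frame. -/
theorem dotProduct_inertia_mulVec (p : Params) (q v : Config) :
    v ⬝ᵥ inertia p q *ᵥ v =
      p.Itot * v 0 ^ 2 + p.IB * v 1 ^ 2 + p.IJ * v 2 ^ 2
      + p.mB * p.lB ^ 2 / 4 * (v 1 ^ 2 + (cos (q 1) * v 0) ^ 2)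
      + p.mJ * (((p.lB * cos (q 1) + p.lJ / 2 * cos (q 2)) * v 0) ^ 2
        + (p.lB * sin (q 1) * v 1 + p.lJ / 2 * sin (q 2) * v 2) ^ 2
        + (p.lB * cos (q 1) * v 1 + p.lJ / 2 * cos (q 2) * v 2) ^ 2)
      + p.m * ((-(p.lB * sin (q 1) * v 1) - p.lJ * sin (q 2) * v 2 + sin (q 5) * v 3
          + q 3 * cos (q 5) * v 5 - q 3 * sin (q 4) * cos (q 5) * v 0) ^ 2
        + (sin (q 4) * cos (q 5) * v 3 + q 3 * cos (q 4) * cos (q 5) * v 4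
          - q 3 * sin (q 4) * sin (q 5) * v 5
          + (p.lB * cos (q 1) + p.lJ * cos (q 2) + q 3 * sin (q 5)) * v 0) ^ 2
        + (p.lB * cos (q 1) * v 1 + p.lJ * cos (q 2) * v 2 - cos (q 4) * cos (q 5) * v 3
          + q 3 * sin (q 4) * cos (q 5) * v 4 + q 3 * cos (q 4) * sin (q 5) * v 5) ^ 2) := by
  simp only [Matrix.mulVec, dotProduct, Fin.sum_univ_six, inertia, inertiaDiag, m₁₂, m₁₃, m₁₄, m₁₅,
    m₁₆, m₂₃, m₂₄, m₂₅, m₂₆, m₃₄, m₃₅, m₃₆, Params.A₁, Params.A₂, Params.A₃, Params.A₄, Params.A₅,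
    cos_sub]
  simp
  -- With sin² = 1 - cos² as the only relations, what remains is a polynomial identity.
  have h1 := sin_sq (q 1)
  have h2 := sin_sq (q 2)
  have h4 := sin_sq (q 4)
  have h5 := sin_sq (q 5)
  generalize sin (q 1) = s1 at *
  generalize sin (q 2) = s2 at *
  generalize sin (q 4) = s4 at *
  generalize sin (q 5) = s5 at *
  generalize cos (q 1) = c1 at *
  generalize cos (q 2) = c2 at *
  generalize cos (q 4) = c4 at *
  generalize cos (q 5) = c5 at *
  grind

theorem dotProduct_inertia_mulVec_nonneg (p : Params) (q v : Config) :
    0 ≤ v ⬝ᵥ inertia p q *ᵥ v := by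
  have := p.m_pos; have := p.mB_pos; have := p.mJ_pos
  have := p.Itot_pos; have := p.IB_pos; have := p.IJ_pos
  rw [dotProduct_inertia_mulVec]
  positivity

theorem Admissible.cos_pos {q : Config} (hq : Admissible q) : 0 < cos (q 4) ∧ 0 < cos (q 5) :=
  ⟨cos_pos_of_mem_Ioo (abs_lt.1 hq.2.1), cos_pos_of_mem_Ioo (abs_lt.1 hq.2.2)⟩

/-- The kinetic energy is definite at admissible configurations. -/
theorem eq_zero_of_dotProduct_inertia_mulVec {p : Params} {q v : Config} (hq : Admissible q)
    (h : v ⬝ᵥ inertia p q *ᵥ v ≤ 0) : v = 0 := by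
  have hm := p.m_pos; have := p.mB_pos; have := p.mJ_pos
  have hI := p.Itot_pos; have hIB := p.IB_pos; have hIJ := p.IJ_pos
  have hd := hq.1
  have hc := hq.cos_pos.2
  rw [dotProduct_inertia_mulVec] at h
  set X := -(p.lB * sin (q 1) * v 1) - p.lJ * sin (q 2) * v 2 + sin (q 5) * v 3
    + q 3 * cos (q 5) * v 5 - q 3 * sin (q 4) * cos (q 5) * v 0 with hX
  set Y := sin (q 4) * cos (q 5) * v 3 + q 3 * cos (q 4) * cos (q 5) * v 4
    - q 3 * sin (q 4) * sin (q 5) * v 5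
    + (p.lB * cos (q 1) + p.lJ * cos (q 2) + q 3 * sin (q 5)) * v 0 with hY
  set Z := p.lB * cos (q 1) * v 1 + p.lJ * cos (q 2) * v 2 - cos (q 4) * cos (q 5) * v 3
    + q 3 * sin (q 4) * cos (q 5) * v 4 + q 3 * cos (q 4) * sin (q 5) * v 5 with hZ
  have b0 : 0 ≤ p.Itot * v 0 ^ 2 := by positivity
  have b1 : 0 ≤ p.IB * v 1 ^ 2 := by positivity
  have b2 : 0 ≤ p.IJ * v 2 ^ 2 := by positivity
  have b3 : 0 ≤ p.mB * p.lB ^ 2 / 4 * (v 1 ^ 2 + (cos (q 1) * v 0) ^ 2) := by positivity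
  have b4 : 0 ≤ p.mJ * (((p.lB * cos (q 1) + p.lJ / 2 * cos (q 2)) * v 0) ^ 2
        + (p.lB * sin (q 1) * v 1 + p.lJ / 2 * sin (q 2) * v 2) ^ 2
        + (p.lB * cos (q 1) * v 1 + p.lJ / 2 * cos (q 2) * v 2) ^ 2) := by positivity
  have b5 : 0 ≤ p.m * (X ^ 2 + Y ^ 2 + Z ^ 2) := by positivity
  have sq_zero : ∀ {c x : ℝ}, 0 < c → c * x ^ 2 ≤ 0 → x = 0 := fun hc h =>
    pow_eq_zero_iff two_ne_zero |>.1 (le_antisymm (nonpos_of_mul_nonpos_right h hc) (sq_nonneg _))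
  have v0 : v 0 = 0 := sq_zero hI (by linarith)
  have v1 : v 1 = 0 := sq_zero hIB (by linarith)
  have v2 : v 2 = 0 := sq_zero hIJ (by linarith)
  have hXYZ : X ^ 2 + Y ^ 2 + Z ^ 2 ≤ 0 := nonpos_of_mul_nonpos_right (by linarith) hm
  -- With slew and luff at rest, this is the squared speed of the payload in spherical coordinates
  -- about the jib tip.
  have hsum : X ^ 2 + Y ^ 2 + Z ^ 2
      = 1 * v 3 ^ 2 + (q 3 * cos (q 5)) ^ 2 * v 4 ^ 2 + q 3 ^ 2 * v 5 ^ 2 := by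
    rw [hX, hY, hZ, v0, v1, v2]
    have h4 := sin_sq (q 4)
    have h5 := sin_sq (q 5)
    generalize sin (q 4) = s4 at *
    generalize sin (q 5) = s5 at *
    generalize cos (q 4) = c4 at *
    generalize cos (q 5) = c5 at *
    grind
  have c3 : 0 ≤ 1 * v 3 ^ 2 := by positivity
  have c4 : 0 ≤ (q 3 * cos (q 5)) ^ 2 * v 4 ^ 2 := by positivity
  have c5 : 0 ≤ q 3 ^ 2 * v 5 ^ 2 := by positivity
  have v3 : v 3 = 0 := sq_zero one_pos (by linarith)
  have v4 : v 4 = 0 := sq_zero (c := (q 3 * cos (q 5)) ^ 2) (by positivity) (by linarith)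
  have v5 : v 5 = 0 := sq_zero (c := q 3 ^ 2) (by positivity) (by linarith)
  ext i
  fin_cases i <;> assumption

/-- A kernel vector would be a nonzero velocity of zero kinetic energy. -/
theorem Admissible.det_inertia_ne_zero {q : Config} (p : Params) (hq : Admissible q) :
    (inertia p q).det ≠ 0 := by
  intro h
  obtain ⟨v, hv, hMv⟩ := Matrix.exists_mulVec_eq_zero_iff.2 h
  exact hv (eq_zero_of_dotProduct_inertia_mulVec hq (by rw [hMv, dotProduct_zero]))

theorem isOpen_admissible : IsOpen {q : Config | Admissible q} := by
  simp only [Admissible, ofPred_and]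
  exact (isOpen_lt (by fun_prop) (by fun_prop)).inter
    ((isOpen_lt (by fun_prop) (by fun_prop)).inter (isOpen_lt (by fun_prop) (by fun_prop)))

theorem inertia_symm (p : Params) (q : Config) (i j : Fin 6) :
    inertia p q i j = inertia p q j i := by
  fin_cases i <;> fin_cases j <;> rfl

/-- Order two is what makes the Coriolis matrix, built from first derivatives, continuously
differentiable. -/
theorem contDiff_inertia (p : Params) (i j : Fin 6) :
    ContDiff ℝ 2 (fun q : Config => inertia p q i j) := by
  fin_cases i <;> fin_cases j <;>
    simp [inertia, inertiaDiag, m₁₂, m₁₃, m₁₄, m₁₅, m₁₆, m₂₃, m₂₄, m₂₅, m₂₆, m₃₄, m₃₅, m₃₆] <;>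
    fun_prop

theorem contDiff_inertiaPartial (p : Params) (k i j : Fin 6) :
    ContDiff ℝ 1 (fun q : Config => inertiaPartial p q k i j) :=
  ((contDiff_inertia p i j).fderiv_right (m := 1) (by norm_num)).clm_apply contDiff_const

theorem fderiv_inertia_apply (p : Params) (q w : Config) (i j : Fin 6) :
    fderiv ℝ (fun x => inertia p x i j) q w = ∑ k, inertiaPartial p q k i j * w k := by
  conv_lhs => rw [pi_eq_sum_univ' w]
  simp [inertiaPartial, mul_comm]

/-- The Coriolis forces do as much work as the change of the inertia matrix. -/
theorem dotProduct_coriolis_mulVec (p : Params) (q v : Config) :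
    v ⬝ᵥ coriolis p q v *ᵥ v
      = 1 / 2 * ∑ i, ∑ j, v i * (∑ k, inertiaPartial p q k i j * v k) * v j := by
  have h1 : v ⬝ᵥ coriolis p q v *ᵥ v
      = ∑ i, ∑ j, ∑ k, v i * inertiaPartial p q k i j * v k * v j
        - 1 / 2 * ∑ i, ∑ j, ∑ k, v i * inertiaPartial p q i k j * v k * v j := by
    simp only [dotProduct, Matrix.mulVec, coriolis, Matrix.of_apply, Finset.mul_sum, Finset.sum_mul,
      ← Finset.sum_sub_distrib]
    refine Finset.sum_congr rfl fun i _ => Finset.sum_congr rfl fun j _ =>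
      Finset.sum_congr rfl fun k _ => ?_
    ring
  -- Interchanging the names of `i` and `k` identifies the two triple sums, so that 1 - 1/2 = 1/2
  -- remains.
  have h2 : ∑ i, ∑ j, ∑ k, v i * inertiaPartial p q i k j * v k * v j
      = ∑ i, ∑ j, ∑ k, v i * inertiaPartial p q k i j * v k * v j := by
    calc _ = ∑ j, ∑ i, ∑ k, v i * inertiaPartial p q i k j * v k * v j := Finset.sum_comm
      _ = ∑ j, ∑ i, ∑ k, v i * inertiaPartial p q k i j * v k * v j := by
        refine Finset.sum_congr rfl fun j _ => ?_
        rw [Finset.sum_comm]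
        refine Finset.sum_congr rfl fun i _ => Finset.sum_congr rfl fun k _ => ?_
        ring
      _ = _ := Finset.sum_comm
  rw [h1, h2]
  simp only [Finset.mul_sum, Finset.sum_mul, ← Finset.sum_sub_distrib]
  refine Finset.sum_congr rfl fun i _ => Finset.sum_congr rfl fun j _ =>
    Finset.sum_congr rfl fun k _ => ?_
  ring

/-- The energy of the closed loop: kinetic energy, payload potential relative to the equilibrium,
and the potential of the proportional controller. -/
noncomputable def energy (p : Params) (K : Gains) (r : Fin 4 → ℝ) (x : State) : ℝ :=
  1 / 2 * (x.2 ⬝ᵥ inertia p x.1 *ᵥ x.2)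
    + p.m * p.g * (x.1 3 * (1 - cos (x.1 4) * cos (x.1 5)))
    + 1 / 2 * (K.kp 0 * (x.1 0 - r 0) ^ 2 + K.kp 1 * (x.1 1 - r 1) ^ 2
      + K.kp 2 * (x.1 2 - r 2) ^ 2 + K.kp 3 * (x.1 3 - r 3) ^ 2)

/-- The power dissipated by the derivative controller and by air friction. -/
noncomputable def dissipation (p : Params) (K : Gains) (x : State) : ℝ :=
  K.kd 0 * x.2 0 ^ 2 + K.kd 1 * x.2 1 ^ 2 + K.kd 2 * x.2 2 ^ 2 + K.kd 3 * x.2 3 ^ 2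
    + p.dθ₁ * cos (x.1 5) ^ 2 * |x.1 4| * x.2 4 ^ 2 + p.dθ₂ * |x.1 5| * x.2 5 ^ 2

theorem energy_desiredState (p : Params) (K : Gains) (r : Fin 4 → ℝ) :
    energy p K r (desiredState r) = 0 := by
  simp [energy, desiredState]

/-- All summands are nonnegative, so nonpositive energy makes each vanish: the velocity by
definiteness, the actuated errors by the gains, and the swing angles because a product of two
cosines in (0, 1] is 1 only if both are. -/
theorem energy_pos {p : Params} {K : Gains} {r : Fin 4 → ℝ} {x : State} (hx : Admissible x.1)
    (hne : x ≠ desiredState r) : 0 < energy p K r x := by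
  by_contra! h
  apply hne
  have hk := K.kp_pos
  have hmg : 0 < p.m * p.g := mul_pos p.m_pos p.g_pos
  obtain ⟨hc4, hc5⟩ := hx.cos_pos
  have e := dotProduct_inertia_mulVec_nonneg p x.1 x.2
  have hcos : cos (x.1 4) * cos (x.1 5) ≤ 1 :=
    mul_le_one₀ (cos_le_one _) hc5.le (cos_le_one _)
  have e' : 0 ≤ p.m * p.g * (x.1 3 * (1 - cos (x.1 4) * cos (x.1 5))) :=
    mul_nonneg hmg.le (mul_nonneg hx.1.le (by linarith))
  have k0 : 0 ≤ K.kp 0 * (x.1 0 - r 0) ^ 2 := mul_nonneg (hk 0).le (sq_nonneg _)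
  have k1 : 0 ≤ K.kp 1 * (x.1 1 - r 1) ^ 2 := mul_nonneg (hk 1).le (sq_nonneg _)
  have k2 : 0 ≤ K.kp 2 * (x.1 2 - r 2) ^ 2 := mul_nonneg (hk 2).le (sq_nonneg _)
  have k3 : 0 ≤ K.kp 3 * (x.1 3 - r 3) ^ 2 := mul_nonneg (hk 3).le (sq_nonneg _)
  rw [energy] at h
  have hv : x.2 = 0 := eq_zero_of_dotProduct_inertia_mulVec hx (by linarith)
  have eq_of : ∀ {c a b : ℝ}, 0 < c → c * (a - b) ^ 2 ≤ 0 → a = b := fun hc h => sub_eq_zero.1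
    (pow_eq_zero_iff two_ne_zero |>.1 (le_antisymm (nonpos_of_mul_nonpos_right h hc) (sq_nonneg _)))
  have hq0 : x.1 0 = r 0 := eq_of (hk 0) (by linarith)
  have hq1 : x.1 1 = r 1 := eq_of (hk 1) (by linarith)
  have hq2 : x.1 2 = r 2 := eq_of (hk 2) (by linarith)
  have hq3 : x.1 3 = r 3 := eq_of (hk 3) (by linarith)
  have hprod : 1 ≤ cos (x.1 4) * cos (x.1 5) := by
    have := nonpos_of_mul_nonpos_right
      (nonpos_of_mul_nonpos_right (by linarith :
        p.m * p.g * (x.1 3 * (1 - cos (x.1 4) * cos (x.1 5))) ≤ 0) hmg) hx.1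
    linarith
  have angle : ∀ {θ : ℝ}, |θ| < π / 2 → 1 ≤ cos θ → θ = 0 := by
    intro θ hθ h1
    have := abs_lt.1 hθ
    exact (cos_eq_one_iff_of_lt_of_lt (by linarith [pi_pos]) (by linarith [pi_pos])).1
      (le_antisymm (cos_le_one _) h1)
  have hq4 : x.1 4 = 0 := angle hx.2.1 (hprod.trans (mul_le_of_le_one_right hc4.le (cos_le_one _)))
  have hq5 : x.1 5 = 0 := angle hx.2.2 (hprod.trans (mul_le_of_le_one_left hc5.le (cos_le_one _)))
  refine Prod.ext ?_ hv
  ext i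
  fin_cases i <;> simpa [desiredState]

theorem differentiable_energy (p : Params) (K : Gains) (r : Fin 4 → ℝ) :
    Differentiable ℝ (energy p K r) := by
  have hM : ∀ i j, Differentiable ℝ (fun x : State => inertia p x.1 i j) := fun i j =>
    ((contDiff_inertia p i j).differentiable (by norm_num)).comp differentiable_fst
  unfold energy
  simp only [Matrix.mulVec, dotProduct]
  fun_prop

/-- The energy balance of the closed loop. -/
theorem fderiv_energy_apply {p : Params} {K : Gains} {r : Fin 4 → ℝ} {q v a : Config}
    (h : EquationOfMotion p q v a (controller p K r q v)) :
    fderiv ℝ (energy p K r) (q, v) (v, a) = -dissipation p K (q, v) := by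
  -- The derivative in the direction `(v, a)` is computed along a straight line.
  set c : ℝ → State := fun s => (q + s • v, v + s • a) with hc
  have hc0 : c 0 = (q, v) := by simp [hc]
  have hcd : HasDerivAt c (v, a) 0 := by
    refine HasDerivAt.prodMk ?_ ?_
    · simpa using ((hasDerivAt_id (0 : ℝ)).smul_const v).const_add q
    · simpa using ((hasDerivAt_id (0 : ℝ)).smul_const a).const_add v
  have hq : ∀ i, HasDerivAt (fun s => (c s).1 i) (v i) 0 := fun i =>
    (hasDerivAt_pi.1 (hasFDerivAt_fst.comp_hasDerivAt 0 hcd)) i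
  have hv : ∀ i, HasDerivAt (fun s => (c s).2 i) (a i) 0 := fun i =>
    (hasDerivAt_pi.1 (hasFDerivAt_snd.comp_hasDerivAt 0 hcd)) i
  have hM : ∀ i j, HasDerivAt (fun s => inertia p (c s).1 i j)
      (∑ k, inertiaPartial p q k i j * v k) 0 := by
    intro i j
    rw [← fderiv_inertia_apply]
    have h1 : HasFDerivAt (fun x => inertia p x i j) (fderiv ℝ (fun x => inertia p x i j) q)
        (c 0).1 := by
      rw [hc0]
      exact (((contDiff_inertia p i j).differentiable (by norm_num)) q).hasFDerivAt
    exact h1.comp_hasDerivAt 0 (hasFDerivAt_fst.comp_hasDerivAt 0 hcd)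
  have hkin : HasDerivAt (fun s => (c s).2 ⬝ᵥ inertia p (c s).1 *ᵥ (c s).2)
      (2 * (v ⬝ᵥ inertia p q *ᵥ a)
        + ∑ i, ∑ j, v i * (∑ k, inertiaPartial p q k i j * v k) * v j) 0 := by
    have h1 : HasDerivAt (fun s => ∑ i, (c s).2 i * ∑ j, inertia p (c s).1 i j * (c s).2 j)
        (∑ i, (a i * ∑ j, inertia p q i j * v j
          + v i * ∑ j, ((∑ k, inertiaPartial p q k i j * v k) * v j + inertia p q i j * a j))) 0 := by
      refine HasDerivAt.fun_sum fun i _ => ?_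
      have := (hv i).fun_mul (HasDerivAt.fun_sum (u := Finset.univ)
        fun j _ => (hM i j).fun_mul (hv j))
      simpa [hc0] using this
    refine h1.congr_deriv ?_
    have hsym : ∑ i, a i * ∑ j, inertia p q i j * v j = v ⬝ᵥ inertia p q *ᵥ a := by
      simp only [dotProduct, Matrix.mulVec, Finset.mul_sum]
      rw [Finset.sum_comm]
      refine Finset.sum_congr rfl fun j _ => Finset.sum_congr rfl fun i _ => ?_
      rw [inertia_symm p q i j]
      ring
    rw [Finset.sum_add_distrib, hsym, two_mul]
    simp only [Finset.sum_add_distrib, mul_add, ← mul_assoc, Finset.mul_sum, dotProduct,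
      Matrix.mulVec]
    ring
  have hpot : HasDerivAt (fun s => (c s).1 3 * (1 - cos ((c s).1 4) * cos ((c s).1 5)))
      (v 3 * (1 - cos (q 4) * cos (q 5))
        + q 3 * (sin (q 4) * v 4 * cos (q 5) + cos (q 4) * (sin (q 5) * v 5))) 0 := by
    refine ((hq 3).mul (((hq 4).cos.mul (hq 5).cos).const_sub 1)).congr_deriv ?_
    simp only [hc0, Pi.mul_apply]
    ring
  have hsq : ∀ (i : Fin 6) (b : ℝ), HasDerivAt (fun s => ((c s).1 i - b) ^ 2)
      (2 * (q i - b) * v i) 0 := by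
    intro i b
    refine (((hq i).sub_const b).pow 2).congr_deriv ?_
    simp [hc0]
  have htot := ((hkin.const_mul (1 / 2)).add (hpot.const_mul (p.m * p.g))).add
    ((((((hsq 0 (r 0)).const_mul (K.kp 0)).add ((hsq 1 (r 1)).const_mul (K.kp 1))).add
      ((hsq 2 (r 2)).const_mul (K.kp 2))).add ((hsq 3 (r 3)).const_mul (K.kp 3))).const_mul (1 / 2))
  have hf : HasFDerivAt (energy p K r) (fderiv ℝ (energy p K r) (q, v)) (c 0) := by
    rw [hc0]
    exact (differentiable_energy p K r (q, v)).hasFDerivAt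
  rw [(hf.comp_hasDerivAt 0 hcd).unique htot]
  -- The equation of motion replaces the inertial power by that of the remaining forces; the
  -- Coriolis power then cancels the derivative of the inertia matrix in `hkin`.
  have hwork : v ⬝ᵥ inertia p q *ᵥ a = v ⬝ᵥ inputMatrix *ᵥ controller p K r q v
      - v ⬝ᵥ coriolis p q v *ᵥ v - v ⬝ᵥ friction p q v - v ⬝ᵥ gravity p q := by
    rw [← h]
    simp only [dotProduct_add]
    ring
  rw [hwork, dotProduct_coriolis_mulVec]
  simp [dotProduct, Matrix.mulVec, Fin.sum_univ_six, Fin.sum_univ_four, inputMatrix, friction,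
    gravity, controller, dissipation]
  ring

theorem dissipation_nonneg (p : Params) (K : Gains) (x : State) : 0 ≤ dissipation p K x := by
  have := (K.kd_pos 0).le; have := (K.kd_pos 1).le
  have := (K.kd_pos 2).le; have := (K.kd_pos 3).le
  have := p.dθ₁_pos; have := p.dθ₂_pos
  unfold dissipation
  positivity

/-- Air friction degenerates where a swing angle is zero, so for these two coordinates only the
product of angle and velocity is controlled. -/
theorem eq_zero_of_dissipation_eq_zero {p : Params} {K : Gains} {x : State} (hx : Admissible x.1)
    (h : dissipation p K x = 0) :
    x.2 0 = 0 ∧ x.2 1 = 0 ∧ x.2 2 = 0 ∧ x.2 3 = 0 ∧ x.1 4 * x.2 4 = 0 ∧ x.1 5 * x.2 5 = 0 := by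
  have hk := K.kd_pos
  have hc := hx.cos_pos.2
  have h1 := p.dθ₁_pos
  have h2 := p.dθ₂_pos
  have k0 : 0 ≤ K.kd 0 * x.2 0 ^ 2 := mul_nonneg (hk 0).le (sq_nonneg _)
  have k1 : 0 ≤ K.kd 1 * x.2 1 ^ 2 := mul_nonneg (hk 1).le (sq_nonneg _)
  have k2 : 0 ≤ K.kd 2 * x.2 2 ^ 2 := mul_nonneg (hk 2).le (sq_nonneg _)
  have k3 : 0 ≤ K.kd 3 * x.2 3 ^ 2 := mul_nonneg (hk 3).le (sq_nonneg _)
  have k4 : 0 ≤ p.dθ₁ * cos (x.1 5) ^ 2 * |x.1 4| * x.2 4 ^ 2 := by positivity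
  have k5 : 0 ≤ p.dθ₂ * |x.1 5| * x.2 5 ^ 2 := by positivity
  have sq_zero : ∀ {c x : ℝ}, 0 < c → c * x ^ 2 ≤ 0 → x = 0 := fun hc h =>
    pow_eq_zero_iff two_ne_zero |>.1 (le_antisymm (nonpos_of_mul_nonpos_right h hc) (sq_nonneg _))
  rw [dissipation] at h
  refine ⟨sq_zero (hk 0) (by linarith), sq_zero (hk 1) (by linarith), sq_zero (hk 2) (by linarith),
    sq_zero (hk 3) (by linarith), ?_, ?_⟩
  · have : p.dθ₁ * cos (x.1 5) ^ 2 * |x.1 4| * x.2 4 ^ 2 = 0 := by linarith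
    simpa [h1.ne', hc.ne'] using this
  · have : p.dθ₂ * |x.1 5| * x.2 5 ^ 2 = 0 := by linarith
    simpa [h2.ne'] using this

end KnuckleCrane

/-! ### Smoothness of determinants and inverse matrices. -/

section SmoothMatrices

variable {E : Type*} [NormedAddCommGroup E] [NormedSpace ℝ E] {n : Type*} [Fintype n]
  [DecidableEq n] {k : WithTop ℕ∞} {A : E → Matrix n n ℝ} {x : E}

theorem ContDiffAt.matrix_det (hA : ∀ i j, ContDiffAt ℝ k (fun y => A y i j) x) :
    ContDiffAt ℝ k (fun y => (A y).det) x := by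
  simp only [Matrix.det_apply']
  exact ContDiffAt.sum fun σ _ => contDiffAt_const.mul (contDiffAt_prod fun i _ => hA _ _)

/-- The inverse is the adjugate divided by the determinant, and the entries of the adjugate are
determinants. -/
theorem ContDiffAt.matrix_inv (hA : ∀ i j, ContDiffAt ℝ k (fun y => A y i j) x)
    (hx : (A x).det ≠ 0) (i j : n) : ContDiffAt ℝ k (fun y => (A y)⁻¹ i j) x := by
  simp only [Matrix.inv_def, Ring.inverse_eq_inv', Matrix.smul_apply, Matrix.adjugate_apply,
    smul_eq_mul]
  refine ((ContDiffAt.matrix_det hA).inv hx).mul (ContDiffAt.matrix_det fun a b => ?_)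
  simp only [Matrix.updateRow_apply]
  split_ifs
  · exact contDiffAt_const
  · exact hA a b

end SmoothMatrices

/-! ### The closed loop as a locally Lipschitz vector field, and its rest points. -/

namespace KnuckleCrane

/-- The forces of the closed loop, with the absolute values in the friction vector replaced by
parameters. -/
noncomputable def force (p : Params) (K : Gains) (r : Fin 4 → ℝ) (y : State × ℝ × ℝ) : Config :=
  inputMatrix *ᵥ controller p K r y.1.1 y.1.2 - coriolis p y.1.1 y.1.2 *ᵥ y.1.2
    - ![0, 0, 0, 0, p.dθ₁ * cos (y.1.1 5) ^ 2 * y.2.1 * y.1.2 4, p.dθ₂ * y.2.2 * y.1.2 5]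
    - gravity p y.1.1

/-- The pair of absolute values of the swing angles, adjoined to the state. -/
def withAbs (x : State) : State × ℝ × ℝ := (x, |x.1 4|, |x.1 5|)

/-- The vector field of the closed loop, as a smooth function of the state and the absolute values
of the swing angles. -/
noncomputable def smoothField (p : Params) (K : Gains) (r : Fin 4 → ℝ) (y : State × ℝ × ℝ) :
    State :=
  (y.1.2, (inertia p y.1.1)⁻¹ *ᵥ force p K r y)

/-- The vector field of the closed loop. -/
noncomputable def field (p : Params) (K : Gains) (r : Fin 4 → ℝ) (x : State) : State :=
  smoothField p K r (withAbs x)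

theorem field_eq (p : Params) (K : Gains) (r : Fin 4 → ℝ) (x : State) :
    field p K r x = (x.2, (inertia p x.1)⁻¹ *ᵥ force p K r (withAbs x)) :=
  rfl

/-- Invertibility of the inertia matrix lets the implicit equations be solved uniquely for the
acceleration. -/
theorem equationOfMotion_iff {p : Params} {K : Gains} {r : Fin 4 → ℝ} {x w : State}
    (hx : Admissible x.1) :
    (w.1 = x.2 ∧ EquationOfMotion p x.1 x.2 w.2 (controller p K r x.1 x.2))
      ↔ w = field p K r x := by
  have hdet : IsUnit (inertia p x.1).det := (hx.det_inertia_ne_zero p).isUnit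
  have hforce : EquationOfMotion p x.1 x.2 w.2 (controller p K r x.1 x.2)
      ↔ inertia p x.1 *ᵥ w.2 = force p K r (withAbs x) := by
    have : force p K r (withAbs x) = inputMatrix *ᵥ controller p K r x.1 x.2
      - coriolis p x.1 x.2 *ᵥ x.2 - friction p x.1 x.2 - gravity p x.1 := rfl
    rw [this, EquationOfMotion, eq_sub_iff_add_eq, eq_sub_iff_add_eq, eq_sub_iff_add_eq]
    constructor <;> intro h <;> rw [← h] <;> abel
  rw [hforce, Prod.ext_iff]
  refine and_congr_right fun _ => ⟨fun h => ?_, fun h => ?_⟩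
  · simp only [field_eq, ← h, Matrix.mulVec_mulVec, Matrix.nonsing_inv_mul _ hdet, Matrix.one_mulVec]
  · simp only [h, field_eq, Matrix.mulVec_mulVec, Matrix.mul_nonsing_inv _ hdet, Matrix.one_mulVec]

theorem contDiff_force (p : Params) (K : Gains) (r : Fin 4 → ℝ) (i : Fin 6) :
    ContDiff ℝ 1 (fun y => force p K r y i) := by
  have hP : ∀ k i j, ContDiff ℝ 1 (fun y : State × ℝ × ℝ => inertiaPartial p y.1.1 k i j) :=
    fun k i j => (contDiff_inertiaPartial p k i j).comp (by fun_prop)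
  have hC : ContDiff ℝ 1 (fun y : State × ℝ × ℝ => (coriolis p y.1.1 y.1.2 *ᵥ y.1.2) i) := by
    simp only [Matrix.mulVec, dotProduct, coriolis, Matrix.of_apply]
    fun_prop
  have hB : ContDiff ℝ 1
      (fun y : State × ℝ × ℝ => (inputMatrix *ᵥ controller p K r y.1.1 y.1.2) i) := by
    simp only [Matrix.mulVec, dotProduct, Fin.sum_univ_four, controller]
    simp
    fun_prop
  simp only [force, Pi.sub_apply]
  refine ((hB.sub hC).sub ?_).sub ?_
  · fin_cases i <;> simp <;> fun_prop
  · fin_cases i <;> simp [gravity] <;> fun_prop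

/-- The vector field of the closed loop is locally Lipschitz at admissible configurations. -/
theorem exists_lipschitzOnWith_field (p : Params) (K : Gains) (r : Fin 4 → ℝ) {x : State}
    (hx : Admissible x.1) : ∃ C, ∃ s ∈ 𝓝 x, LipschitzOnWith C (field p K r) s := by
  have hM : ∀ i j, ContDiffAt ℝ 1 (fun y : State × ℝ × ℝ => inertia p y.1.1 i j) (withAbs x) :=
    fun i j => (((contDiff_inertia p i j).of_le (by norm_num)).comp
      (contDiff_fst.comp contDiff_fst)).contDiffAt
  have hinv : ∀ i j, ContDiffAt ℝ 1 (fun y : State × ℝ × ℝ => (inertia p y.1.1)⁻¹ i j)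
      (withAbs x) := ContDiffAt.matrix_inv hM (by
        simpa only [withAbs] using hx.det_inertia_ne_zero p)
  have hG : ContDiffAt ℝ 1 (smoothField p K r) (withAbs x) := by
    unfold smoothField
    refine ContDiffAt.prodMk (by fun_prop) (contDiffAt_pi.2 fun i => ?_)
    simp only [Matrix.mulVec, dotProduct]
    exact ContDiffAt.sum fun j _ => (hinv i j).mul (contDiff_force p K r j).contDiffAt
  -- A C¹ map is locally Lipschitz, and the absolute values enter only through the 1-Lipschitz map
  -- `withAbs`.
  obtain ⟨C, s, hs, hC⟩ := hG.exists_lipschitzOnWith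
  have habs : ∀ i : Fin 6, LipschitzWith 1 (fun x : State => |x.1 i|) := fun i => by
    simpa using! (lipschitzWith_one_norm (E := ℝ)).comp
      ((LipschitzWith.eval (α := fun _ : Fin 6 => ℝ) i).comp
        (LipschitzWith.prod_fst (α := Config) (β := Config)))
  have hlip : LipschitzWith 1 withAbs := by
    simpa using! LipschitzWith.id.prodMk ((habs 4).prodMk (habs 5))
  exact ⟨C * 1, withAbs ⁻¹' s, hlip.continuous.continuousAt hs,
    hC.comp hlip.lipschitzOnWith (mapsTo_preimage _ _)⟩

/-- The nearest-point retraction to a closed ball of the state space. -/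
noncomputable def clamp (c : State) (R : ℝ) (x : State) : State :=
  (fun i => max (c.1 i - R) (min (c.1 i + R) (x.1 i)),
    fun i => max (c.2 i - R) (min (c.2 i + R) (x.2 i)))

/-- In the sup metric a closed ball is a box, and the retraction truncates each coordinate
separately. -/
theorem lipschitzWith_clamp (c : State) (R : ℝ) : LipschitzWith 1 (clamp c R) := by
  have h : ∀ a b : ℝ, LipschitzWith 1 (fun s : ℝ => max a (min b s)) := fun a b =>
    (LipschitzWith.id.const_min b).const_max a
  have hpi : ∀ c : Config, LipschitzWith 1
      (fun (q : Config) i => max (c i - R) (min (c i + R) (q i))) := fun c =>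
    LipschitzWith.of_dist_le_mul fun x y => by
      rw [NNReal.coe_one, one_mul]
      refine (dist_pi_le_iff dist_nonneg).2 fun i => ?_
      refine ((h (c i - R) (c i + R)).dist_le_mul (x i) (y i)).trans ?_
      simpa using dist_le_pi_dist x y i
  simpa using! ((hpi c.1).comp LipschitzWith.prod_fst).prodMk
    ((hpi c.2).comp LipschitzWith.prod_snd)

theorem clamp_mem (c : State) {R : ℝ} (hR : 0 ≤ R) (x : State) :
    clamp c R x ∈ Metric.closedBall c R := by
  have h : ∀ a b : ℝ, dist (max (a - R) (min (a + R) b)) a ≤ R := by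
    intro a b
    rw [Real.dist_eq, abs_le]
    constructor
    · linarith [le_max_left (a - R) (min (a + R) b)]
    · have : max (a - R) (min (a + R) b) ≤ a + R :=
        max_le (by linarith) (min_le_left _ _)
      linarith
  exact max_le ((dist_pi_le_iff hR).2 fun i => h _ _) ((dist_pi_le_iff hR).2 fun i => h _ _)

theorem clamp_eq_self {c : State} {R : ℝ} {x : State} (hx : x ∈ Metric.closedBall c R) :
    clamp c R x = x := by
  have h : ∀ a b : ℝ, dist b a ≤ R → max (a - R) (min (a + R) b) = b := by
    intro a b hb
    rw [Real.dist_eq, abs_le] at hb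
    rw [min_eq_right (by linarith), max_eq_right (by linarith)]
  have hx' := max_le_iff.1 (Metric.mem_closedBall.1 hx)
  ext i
  · exact h _ _ ((dist_le_pi_dist _ _ i).trans hx'.1)
  · exact h _ _ ((dist_le_pi_dist _ _ i).trans hx'.2)

theorem field_desiredState {p : Params} {K : Gains} {r : Fin 4 → ℝ}
    (hr : Admissible (desiredState r).1) : field p K r (desiredState r) = 0 := by
  symm
  rw [← equationOfMotion_iff hr]
  refine ⟨rfl, ?_⟩
  simp only [EquationOfMotion, desiredState]
  ext i
  fin_cases i <;>
    simp [friction, gravity, inputMatrix, controller, Matrix.mulVec, dotProduct,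
      Fin.sum_univ_four] <;> ring

/-- The desired configuration is the only admissible one at which the crane can rest. -/
theorem eq_desiredState_of_rest {p : Params} {K : Gains} {r : Fin 4 → ℝ} {q : Config}
    (hq : Admissible q) (h : EquationOfMotion p q 0 0 (controller p K r q 0)) :
    q = (desiredState r).1 := by
  have hk := fun i => (K.kp_pos i).ne'
  obtain ⟨hc4, hc5⟩ := hq.cos_pos
  have hm := p.m_pos.ne'
  have hg := p.g_pos.ne'
  have hd := hq.1.ne'
  have angle : ∀ {θ : ℝ}, |θ| < π / 2 → sin θ = 0 → θ = 0 := by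
    intro θ hθ h1
    have := abs_lt.1 hθ
    exact (sin_eq_zero_iff_of_lt_of_lt (by linarith [pi_pos]) (by linarith [pi_pos])).1 h1
  have e := fun i => congrFun h i
  simp only [Matrix.mulVec_zero, zero_add, Pi.add_apply] at e
  have e0 := e 0
  have e1 := e 1
  have e2 := e 2
  have e3 := e 3
  have e4 := e 4
  have e5 := e 5
  simp [friction, gravity, inputMatrix, controller, Matrix.mulVec, dotProduct,
    Fin.sum_univ_four] at e0 e1 e2 e3 e4 e5
  have q4 : q 4 = 0 := by
    refine angle hq.2.1 ?_
    simpa [hc5.ne', hm, hg, hd] using e4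
  have q5 : q 5 = 0 := by
    refine angle hq.2.2 ?_
    simpa [hc4.ne', hm, hg, hd] using e5
  have eq_of : ∀ {c a b : ℝ}, c ≠ 0 → c * (a - b) = 0 → b = a := fun hc h =>
    (sub_eq_zero.1 ((mul_eq_zero.1 h).resolve_left hc)).symm
  have q0 : q 0 = r 0 := eq_of (hk 0) (by simpa using e0)
  have q1 : q 1 = r 1 := eq_of (hk 1) (by linarith)
  have q2 : q 2 = r 2 := eq_of (hk 2) (by linarith)
  -- The rope force compensates the payload weight exactly only at zero swing, so the angles have to
  -- be known first.
  have q3 : q 3 = r 3 := by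
    rw [q4, q5, cos_zero] at e3
    exact eq_of (hk 3) (by linarith)
  ext i
  fin_cases i <;> simpa [desiredState]

/-- A function on the unit interval whose product with its derivative vanishes has derivative
zero. -/
theorem deriv_eq_zero_of_mul_deriv_eq_zero {θ ω : ℝ → ℝ}
    (hθ : ∀ t ∈ Icc (0 : ℝ) 1, HasDerivWithinAt θ (ω t) (Icc 0 1) t)
    (h : ∀ t ∈ Icc (0 : ℝ) 1, θ t * ω t = 0) : ∀ t ∈ Icc (0 : ℝ) 1, ω t = 0 := by
  -- The derivative of θ² is 2 θ θ' = 0, so θ² is constant. If θ' were nonzero at one time, θ would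
  -- vanish there, hence everywhere, and its derivative with it.
  have hsq : ∀ t ∈ Icc (0 : ℝ) 1, HasDerivWithinAt (fun s => θ s ^ 2) 0 (Icc 0 1) t := by
    intro t ht
    refine ((hθ t ht).pow 2).congr_deriv ?_
    simp [mul_assoc, h t ht]
  have hconst : ∀ t ∈ Icc (0 : ℝ) 1, ∀ s ∈ Icc (0 : ℝ) 1, θ s ^ 2 = θ t ^ 2 := by
    intro t ht s hs
    have := (convex_Icc (0 : ℝ) 1).norm_image_sub_le_of_norm_hasDerivWithin_le hsq
      (C := 0) (by simp) ht hs
    simpa [sub_eq_zero] using this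
  intro t ht
  by_contra hω
  have h0 : θ t = 0 := (mul_eq_zero.1 (h t ht)).resolve_right hω
  have hzero : ∀ s ∈ Icc (0 : ℝ) 1, θ s = 0 := fun s hs => by
    simpa [h0] using hconst t ht s hs
  exact hω ((uniqueDiffOn_Icc zero_lt_one t ht).eq_deriv _ (hθ t ht)
    ((hasDerivWithinAt_const t (Icc 0 1) (0 : ℝ)).congr hzero (hzero t ht)))

/-- The equilibrium is the only solution that does not dissipate energy. -/
theorem eq_desiredState_of_dissipation_eq_zero {p : Params} {K : Gains} {r : Fin 4 → ℝ}
    {φ : ℝ → State}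
    (hφ : ∀ t ∈ Icc (0 : ℝ) 1, HasDerivWithinAt φ (field p K r (φ t)) (Icc 0 1) t)
    (hadm : ∀ t ∈ Icc (0 : ℝ) 1, Admissible (φ t).1)
    (hdis : ∀ t ∈ Icc (0 : ℝ) 1, dissipation p K (φ t) = 0) : φ 0 = desiredState r := by
  have h0 : (0 : ℝ) ∈ Icc (0 : ℝ) 1 := left_mem_Icc.2 zero_le_one
  have hq : ∀ i, ∀ t ∈ Icc (0 : ℝ) 1,
      HasDerivWithinAt (fun s => (φ s).1 i) ((φ t).2 i) (Icc 0 1) t := fun i t ht =>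
    (hasDerivWithinAt_pi.1 (hasFDerivAt_fst.comp_hasDerivWithinAt t (hφ t ht))) i
  have hz := fun t ht => eq_zero_of_dissipation_eq_zero (hadm t ht) (hdis t ht)
  have h4 := deriv_eq_zero_of_mul_deriv_eq_zero (hq 4) (fun t ht => (hz t ht).2.2.2.2.1)
  have h5 := deriv_eq_zero_of_mul_deriv_eq_zero (hq 5) (fun t ht => (hz t ht).2.2.2.2.2)
  have hv : ∀ t ∈ Icc (0 : ℝ) 1, (φ t).2 = 0 := by
    intro t ht
    obtain ⟨z0, z1, z2, z3, -, -⟩ := hz t ht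
    ext i
    fin_cases i
    exacts [z0, z1, z2, z3, h4 t ht, h5 t ht]
  -- The velocity is zero on the whole interval, so the acceleration is zero as well and the state
  -- is one of rest.
  have ha : (field p K r (φ 0)).2 = 0 :=
    (uniqueDiffOn_Icc zero_lt_one 0 h0).eq_deriv _
      (hasFDerivAt_snd.comp_hasDerivWithinAt 0 (hφ 0 h0))
      ((hasDerivWithinAt_const 0 (Icc 0 1) (0 : Config)).congr hv (hv 0 h0))
  have hEOM := ((equationOfMotion_iff (hadm 0 h0)).2 (rfl : field p K r (φ 0) = _)).2
  rw [ha, hv 0 h0] at hEOM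
  exact Prod.ext (eq_desiredState_of_rest (hadm 0 h0) hEOM) (hv 0 h0)

end KnuckleCrane

/-! ### Asymptotic stability of the crane. -/

open KnuckleCrane in
theorem mainTheorem1 (p : KnuckleCrane.Params) (K : KnuckleCrane.Gains) (r : Fin 4 → ℝ)
    (hr : KnuckleCrane.Admissible (KnuckleCrane.desiredState r).1) :
    IsAsymptoticallyStable (KnuckleCrane.IsClosedLoopSolution p K r)
      (KnuckleCrane.desiredState r) := by
  obtain ⟨C, s, hs, hlip⟩ := exists_lipschitzOnWith_field p K r hr
  have hadm : {x : State | Admissible x.1} ∈ 𝓝 (desiredState r) :=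
    (isOpen_admissible.preimage continuous_fst).mem_nhds hr
  -- On this ball the field is Lipschitz and every configuration is admissible.
  obtain ⟨R, hR, hball⟩ := Metric.nhds_basis_closedBall.mem_iff.1 (inter_mem hs hadm)
  have hballs := hball.trans inter_subset_left
  have hballadm : ∀ y ∈ Metric.closedBall (desiredState r) R, Admissible y.1 :=
    fun y hy => (hball hy).2
  have hfield : ∀ y ∈ Metric.closedBall (desiredState r) R,
      field p K r (clamp (desiredState r) R y) = field p K r y :=
    fun y hy => by rw [clamp_eq_self hy]
  have hcenter := Metric.mem_closedBall_self (x := desiredState r) hR.le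
  have hlipB := hlip.mono hballs
  have hpower : ∀ y ∈ Metric.closedBall (desiredState r) R,
      fderiv ℝ (energy p K r) y (field p K r y) = -dissipation p K y := fun y hy =>
    fderiv_energy_apply ((equationOfMotion_iff (hballadm y hy)).2 (rfl : field p K r y = _)).2
  have hsol : IsClosedLoopSolution p K r = fun I x => ∀ t ∈ I, ∃ w, HasDerivWithinAt x w I t ∧
      (w.1 = (x t).2 ∧
        EquationOfMotion p (x t).1 (x t).2 w.2 (controller p K r (x t).1 (x t).2)) := by
    ext I x
    refine forall₂_congr fun t _ => ⟨?_, ?_⟩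
    · rintro ⟨a, ha, hE⟩
      exact ⟨_, ha, rfl, hE⟩
    · rintro ⟨⟨_, a⟩, ha, rfl, hE⟩
      exact ⟨a, ha, hE⟩
  rw [hsol]
  -- The field vanishes at the centre and is `C`-Lipschitz on the ball, which gives the bound `C`
  -- times `R`; the factor 1 in `C * 1` is the Lipschitz constant of `clamp`.
  refine isAsymptoticallyStable_of_lyapunov (f := fun y => field p K r (clamp (desiredState r) R y))
    (V := energy p K r) (V' := fderiv ℝ (energy p K r)) (K := C * 1) (L := C * ⟨R, hR.le⟩)
    (G := fun y w => w.1 = y.2 ∧ EquationOfMotion p y.1 y.2 w.2 (controller p K r y.1 y.2))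
    hR ?_ (fun y => ?_) ?_ (fun y hy w => ?_)
    (fun y _ => (differentiable_energy p K r y).hasFDerivAt) (fun y hy => ?_)
    (energy_desiredState p K r) (fun y hy hne => energy_pos (hballadm y hy) hne) fun φ hφ => ?_
  · exact lipschitzOnWith_univ.1 (hlipB.comp (lipschitzWith_clamp _ R).lipschitzOnWith
      fun y _ => clamp_mem _ hR.le y)
  · have hy := clamp_mem (desiredState r) hR.le y
    have := hlipB.dist_le_mul _ hy _ hcenter
    rw [field_desiredState hr, dist_zero_right] at this
    exact this.trans (mul_le_mul_of_nonneg_left (Metric.mem_closedBall.1 hy) C.coe_nonneg)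
  · rw [hfield _ hcenter, field_desiredState hr]
  · rw [hfield y hy, equationOfMotion_iff (hballadm y hy)]
  · rw [hfield y hy, hpower y hy]
    exact neg_nonpos.2 (dissipation_nonneg p K y)
  · refine eq_desiredState_of_dissipation_eq_zero (p := p) (K := K) (fun t ht => ?_)
      (fun t ht => hballadm _ (hφ t ht).2.1) fun t ht => ?_
    · have := (hφ t ht).1
      rwa [hfield _ (hφ t ht).2.1] at this
    · have := (hφ t ht).2.2
      rwa [hfield _ (hφ t ht).2.1, hpower _ (hφ t ht).2.1, neg_eq_zero] at this
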